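/- Definitions. A multiplicative lattice is a commutative monoid $\mathcal L$ with a partial order making it a complete lattice, such that $x\bigl(\bigvee_{y\in S}y\bigr)=\bigvee_{y\in S}xy$ for all $x\in\mathcal L$ and $S\subseteq\mathcal L$, and such that the top element $1$ is the multiplicative identity; its bottom element is denoted by $0$. It is a domain if $ab=0$ implies $a=0$ or $b=0$. It is a $C$-lattice if $1$ is compact, products of compact elements are compact, and every element is a join of compact elements. For $x,y\in\mathcal L$ put $(y:x)=\bigvee\{a\mid ax\le y\}$ and $\sqrt x=\bigvee\{y\mid y^n\le x\text{ for some }n\ge 1\}$. The element $x$ is $\ell$-radical if $x=\sqrt x$; it is $\ell$-principal if $y\wedge zx=((y:x)\wedge z)x$ and $y\vee(z:x)=((yx\vee z):x)$ for all $y,z\in\mathcal L$. The lattice $\mathcal L$ is principally generated if every element is a join of $\ell$-principal elements, and radical factorial if every element is a finite product of $\ell$-radical elements. $X_{\mathcal L}$ denotes the set of maximal elements of $\mathcal L$ (the elements maximal among those different from $1$) with the inverse topology, which has as a basis of open sets the sets $V(x)=\{m\in X_{\mathcal L}\mid x\le m\}$ with $x\in\mathcal L$ compact. Corollary 6.6.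 Let $\mathcal L$ and $\mathcal L'$ be principally generated radical factorial $C$-lattice domains, and assume that either both or neither of them have exactly two elements (equivalently, $0$ is a maximal element of $\mathcal L$ if and only if $0$ is a maximal element of $\mathcal L'$). Then $\mathcal L$ and $\mathcal L'$ are isomorphic as multiplicative lattices (i.e. there is a bijection $\mathcal L\to\mathcal L'$ that preserves products and preserves and reflects the order) if and only if the topological spaces $X_{\mathcal L}$ and $X_{\mathcal L'}$ are homeomorphic. -/

import Mathlib

/-- A commutative monoid that is also a complete lattice is a *multiplicative lattice* if
multiplication distributes over arbitrary joins (this is `IsQuantale`; the empty join is included,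
so `x * ⊥ = ⊥`) and the top element is the multiplicative identity. The elements written `0` and
`1` in the literature are `⊥` and `1 = ⊤`. -/
class IsMultiplicativeLattice (L : Type*) [CommMonoid L] [CompleteLattice L] : Prop
    extends IsQuantale L where
  one_eq_top : (1 : L) = ⊤

namespace MultiplicativeLattice

section Order

variable (L : Type*) [CompleteLattice L]

/-- The set `Max(L)` of maximal elements of `L`, i.e. of the elements `m ≠ 1` that are maximal
among the elements different from the top element `1`. -/
def MaxSpace : Type _ := {m : L // IsCoatom m}

variable {L}

/-- `V(x)`, the set of maximal elements above `x`. -/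
def V (x : L) : Set (MaxSpace L) := {m | x ≤ m.1}

/-- The *inverse topology* on `Max(L)`, whose basic open sets are the sets `V(x)` with `x` a compact
element of `L`. (These are closed under finite intersections, as `V(⊥) = Max(L)` and
`V(x) ∩ V(y) = V(x ⊔ y)`.) -/
instance : TopologicalSpace (MaxSpace L) :=
  TopologicalSpace.generateFrom {U | ∃ x : L, IsCompactElement x ∧ U = V x}

end Order

section Mul

variable {L : Type*} [CommMonoid L] [CompleteLattice L]

/-- The residual `(y : x) = ⋁ {a | a x ≤ y}`. -/
def colon (y x : L) : L := sSup {a | a * x ≤ y}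

/-- `√x = ⋁ {y | y ^ n ≤ x for some n ≥ 1}`. -/
def lRadical (x : L) : L := sSup {y | ∃ n : ℕ, 1 ≤ n ∧ y ^ n ≤ x}

/-- `x` is *`ℓ`-radical* if `x = √x`. -/
def IsLRadical (x : L) : Prop := x = lRadical x

/-- `x` is *meet principal* if `y ∧ z x = ((y : x) ∧ z) x` for all `y`, `z`. -/
def IsMeetPrincipal (x : L) : Prop :=
  ∀ y z : L, y ⊓ z * x = (colon y x ⊓ z) * x

/-- `x` is *join principal* if `y ∨ (z : x) = ((y x ∨ z) : x)` for all `y`, `z`. -/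
def IsJoinPrincipal (x : L) : Prop :=
  ∀ y z : L, y ⊔ colon z x = colon (y * x ⊔ z) x

/-- `x` is *`ℓ`-principal* if it is both meet principal and join principal. -/
def IsLPrincipal (x : L) : Prop := IsMeetPrincipal x ∧ IsJoinPrincipal x

variable (L)

/-- `L` is *principally generated* if every element is a join of `ℓ`-principal elements. -/
def IsPrincipallyGenerated : Prop :=
  ∀ x : L, ∃ S : Set L, (∀ a ∈ S, IsLPrincipal a) ∧ sSup S = x

/-- `L` is a *C-lattice* if its set of compact elements is multiplicatively closed (contains `1` and
is closed under products) and every element is a join of compact elements. -/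
structure IsCLattice : Prop where
  one_compact : IsCompactElement (1 : L)
  mul_compact : ∀ x y : L, IsCompactElement x → IsCompactElement y → IsCompactElement (x * y)
  isCompactlyGenerated : IsCompactlyGenerated L

/-- `L` is a *domain* if `a b = 0` implies `a = 0` or `b = 0`. -/
def IsLatticeDomain : Prop :=
  ∀ a b : L, a * b = ⊥ → a = ⊥ ∨ b = ⊥

/-- `L` is *radical factorial* if every element is a (finite) product of `ℓ`-radical elements. -/
def IsRadicalFactorial : Prop :=
  ∀ x : L, ∃ s : Multiset L, (∀ a ∈ s, IsLRadical a) ∧ s.prod = x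

/-- `L` is a principally generated radical factorial C-lattice domain. -/
structure IsPrincipallyGeneratedRadicalFactorialCLatticeDomain : Prop where
  isCLattice : IsCLattice L
  isLatticeDomain : IsLatticeDomain L
  isPrincipallyGenerated : IsPrincipallyGenerated L
  isRadicalFactorial : IsRadicalFactorial L

end Mul

end MultiplicativeLattice

set_option linter.unusedSectionVars false

namespace MultiplicativeLattice

/-! ### Residuals, prime elements and principal elements. -/

section Basic

variable {L : Type*} [CommMonoid L] [CompleteLattice L] [IsMultiplicativeLattice L]

/-! Say that `x` lies below `y` locally at a prime `p` when `colon y x` is not below `p`. Apart from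
the degenerate lattices, such a lattice behaves like the ideals of a one-dimensional domain whose
localizations are discrete valuation rings. Each maximal `m` is locally generated by one principal
element (`exists_isUniformizer`), every nonzero prime is maximal (`IsPrimeElement.isCoatom`), and a
nonzero `x` is determined by its multiplicities at the maximal elements, which reverse the order and
turn products into sums (`le_iff_multiplicity_le`, `multiplicity_mul`).

The functions arising in this way are exactly the bounded ones whose superlevel sets at levels `n ≥
1` are compact in the inverse topology (`isMultiplicityFunction_multiplicity`,
`IsMultiplicityFunction.exists_multiplicity_eq`). This description uses only the topological space,
so a homeomorphism matches the nonzero elements of the two lattices. The condition on `⊥` is needed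
because the two-element lattice and the ideal lattice of a discrete valuation ring both have a
one-point space. Conversely, the space is built from the order alone. -/

theorem le_one' (x : L) : x ≤ 1 :=
  (le_top (a := x)).trans_eq IsMultiplicativeLattice.one_eq_top.symm

theorem eq_one_of_one_le {x : L} (h : 1 ≤ x) : x = 1 := le_antisymm (le_one' x) h

theorem mul_le_left' (x y : L) : x * y ≤ x := by
  simpa using mul_le_mul' (le_refl x) (le_one' y)

theorem mul_le_right' (x y : L) : x * y ≤ y := by
  simpa using mul_le_mul' (le_one' x) (le_refl y)

theorem bot_mul' (x : L) : ⊥ * x = ⊥ := le_bot_iff.1 (mul_le_left' ⊥ x)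

theorem mul_bot' (x : L) : x * ⊥ = ⊥ := le_bot_iff.1 (mul_le_right' x ⊥)

theorem le_colon_iff {x y z : L} : z ≤ colon y x ↔ z * x ≤ y :=
  Quantale.leftMulResiduation_le_iff_mul_le

theorem colon_mul_le (y x : L) : colon y x * x ≤ y := le_colon_iff.1 le_rfl

theorem le_colon_self (y x : L) : y ≤ colon y x := le_colon_iff.2 (mul_le_left' y x)

theorem colon_mono {y y' x x' : L} (h : y ≤ y') (h' : x' ≤ x) : colon y x ≤ colon y' x' :=
  le_colon_iff.2 ((mul_le_mul' le_rfl h').trans ((colon_mul_le y x).trans h))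

theorem colon_one (y : L) : colon y 1 = y :=
  le_antisymm (by simpa using colon_mul_le y 1) (le_colon_self y 1)

theorem colon_eq_one {y x : L} (h : x ≤ y) : colon y x = 1 :=
  eq_one_of_one_le (le_colon_iff.2 (by simpa using h))

theorem colon_colon (y x x' : L) : colon (colon y x') x = colon y (x * x') := by
  refine le_antisymm (le_colon_iff.2 ?_) (le_colon_iff.2 (le_colon_iff.2 ?_))
  · rw [← mul_assoc]
    exact (mul_le_mul' (colon_mul_le _ _) le_rfl).trans (colon_mul_le _ _)
  · rw [mul_assoc]
    exact colon_mul_le _ _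

theorem colon_mul_colon_le (x y x' y' : L) :
    colon x y * colon x' y' ≤ colon (x * x') (y * y') := by
  rw [le_colon_iff, mul_mul_mul_comm]
  exact mul_le_mul' (colon_mul_le _ _) (colon_mul_le _ _)

theorem colon_mul_colon_le_colon (x y z : L) : colon x y * colon y z ≤ colon x z := by
  rw [le_colon_iff, mul_assoc]
  exact (mul_le_mul' le_rfl (colon_mul_le _ _)).trans (colon_mul_le _ _)

theorem pow_le_pow_of_le_one' (x : L) {k n : ℕ} (h : k ≤ n) : x ^ n ≤ x ^ k := by
  obtain ⟨j, rfl⟩ := Nat.exists_eq_add_of_le h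
  rw [pow_add]
  exact mul_le_left' _ _

theorem IsLRadical.le_of_pow_le {r y : L} (hr : IsLRadical r) {n : ℕ} (h : y ^ n ≤ r) :
    y ≤ r := by
  rcases Nat.eq_zero_or_pos n with rfl | hn
  · rw [pow_zero] at h
    exact (le_one' y).trans h
  · rw [IsLRadical] at hr
    rw [hr]
    exact le_sSup ⟨n, hn, h⟩

theorem le_lRadical (x : L) : x ≤ lRadical x := le_sSup ⟨1, le_rfl, by simp⟩

/-- Prime elements of a multiplicative lattice. -/
structure IsPrimeElement (p : L) : Prop where
  ne_one : p ≠ 1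
  le_or_le : ∀ a b : L, a * b ≤ p → a ≤ p ∨ b ≤ p

theorem IsPrimeElement.not_mul_le {p a b : L} (hp : IsPrimeElement p) (ha : ¬ a ≤ p)
    (hb : ¬ b ≤ p) : ¬ a * b ≤ p := fun h => (hp.le_or_le a b h).elim ha hb

theorem IsPrimeElement.not_one_le {p : L} (hp : IsPrimeElement p) : ¬ 1 ≤ p :=
  fun h => hp.ne_one (eq_one_of_one_le h)

theorem IsPrimeElement.isLRadical {p : L} (hp : IsPrimeElement p) : IsLRadical p := by
  refine le_antisymm (le_lRadical p) (sSup_le ?_)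
  rintro y ⟨n, -, hn⟩
  induction n with
  | zero => exact absurd (by simpa using hn) hp.not_one_le
  | succ n ih =>
    rw [pow_succ] at hn
    exact (hp.le_or_le _ _ hn).elim ih id

theorem IsPrimeElement.exists_le_of_prod_le {p : L} (hp : IsPrimeElement p) {s : Multiset L}
    (h : s.prod ≤ p) : ∃ a ∈ s, a ≤ p := by
  induction s using Multiset.induction_on with
  | empty => exact absurd (by simpa using h) hp.not_one_le
  | cons a s ih =>
    rw [Multiset.prod_cons] at h
    rcases hp.le_or_le _ _ h with h | h
    · exact ⟨a, by simp, h⟩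
    · obtain ⟨b, hb, hbp⟩ := ih h
      exact ⟨b, by simp [hb], hbp⟩

theorem isPrimeElement_of_isCoatom {m : L} (hm : IsCoatom m) : IsPrimeElement m := by
  refine ⟨fun h => hm.1 (h.trans IsMultiplicativeLattice.one_eq_top), fun a b hab => ?_⟩
  by_contra! h
  have key : ∀ a : L, ¬ a ≤ m → m ⊔ a = 1 := fun a ha => by
    rw [IsMultiplicativeLattice.one_eq_top]
    exact hm.2 _ (left_lt_sup.2 ha)
  have h1 : (m ⊔ a) * (m ⊔ b) ≤ m := by
    rw [Quantale.mul_sup_distrib, Quantale.sup_mul_distrib (z := b)]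
    exact sup_le (mul_le_right' _ _) (sup_le (mul_le_left' _ _) hab)
  rw [key a h.1, key b h.2, mul_one] at h1
  exact hm.1 (top_le_iff.1 (IsMultiplicativeLattice.one_eq_top (L := L) ▸ h1))

/-- If `w` is compact and lies below the join of elements each of which lies below `z` locally
at the prime element `p`, then so does `w`. -/
theorem IsPrimeElement.not_colon_le_of_le_sSup {p : L} (hp : IsPrimeElement p) {z w : L}
    (hw : IsCompactElement w) {S : Set L} (hwS : w ≤ sSup S) (hS : ∀ s ∈ S, ¬ colon z s ≤ p) :
    ¬ colon z w ≤ p := by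
  obtain ⟨t, htS, hwt⟩ :=
    (CompleteLattice.isCompactElement_iff_exists_le_sSup_of_le_sSup L w).1 hw S hwS
  have key : ¬ colon z (t.sup id) ≤ p := by
    refine Finset.sup_induction (p := fun a => ¬ colon z a ≤ p) ?_ ?_ fun s hs => hS s (htS hs)
    · rw [colon_eq_one bot_le]
      exact hp.not_one_le
    · intro a ha b hb h
      refine hp.not_mul_le ha hb (le_trans ?_ h)
      rw [le_colon_iff, Quantale.mul_sup_distrib]
      refine sup_le ?_ ?_
      · rw [mul_right_comm]
        exact (mul_le_left' _ _).trans (colon_mul_le _ _)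
      · rw [mul_assoc]
        exact (mul_le_right' _ _).trans (colon_mul_le _ _)
  exact fun h => key ((colon_mono le_rfl hwt).trans h)

theorem IsLPrincipal.mul {x x' : L} (hx : IsLPrincipal x) (hx' : IsLPrincipal x') :
    IsLPrincipal (x * x') := by
  constructor
  · intro y z
    rw [← mul_assoc z, hx'.1, hx.1, colon_colon, mul_assoc]
  · intro y z
    rw [← colon_colon, ← colon_colon, ← mul_assoc, ← hx'.2, ← hx.2]

theorem isLPrincipal_one : IsLPrincipal (1 : L) :=
  ⟨fun y z => by rw [mul_one, mul_one, colon_one],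
    fun y z => by rw [mul_one, colon_one, colon_one]⟩

theorem IsLPrincipal.pow {x : L} (hx : IsLPrincipal x) (n : ℕ) : IsLPrincipal (x ^ n) := by
  induction n with
  | zero => simpa using isLPrincipal_one
  | succ n ih => rw [pow_succ]; exact ih.mul hx

theorem IsLPrincipal.colon_mul_eq {x y : L} (hx : IsLPrincipal x) (h : y ≤ x) :
    colon y x * x = y := by
  have := hx.1 y 1
  rw [one_mul, inf_eq_left.2 h, inf_eq_left.2 (le_one' _)] at this
  exact this.symm

/-- Meet principality turns a directed cover of `a` by elements `s` into `a ≤ (⋁ colon s a) * a`.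
Join principality cancels `a` up to `colon ⊥ a`, which every `colon s a` absorbs. So the residuals
cover `1`, and compactness of `1` applies. -/
theorem IsLPrincipal.isCompactElement [IsCompactlyGenerated L] (h1 : IsCompactElement (1 : L))
    {a : L} (ha : IsLPrincipal a) : IsCompactElement a := by
  rw [CompleteLattice.isCompactElement_iff_le_of_directed_sSup_le] at h1 ⊢
  intro S hne hdir hle
  have hdir' : DirectedOn (· ≤ ·) ((fun s => colon s a) '' S) := by
    rintro _ ⟨s, hs, rfl⟩ _ ⟨t, ht, rfl⟩
    obtain ⟨u, hu, hsu, htu⟩ := hdir s hs t ht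
    exact ⟨_, ⟨u, hu, rfl⟩, colon_mono hsu le_rfl, colon_mono htu le_rfl⟩
  have hle' : a ≤ sSup ((fun s => colon s a) '' S) * a := by
    conv_lhs => rw [← inf_eq_left.2 hle, hdir.inf_sSup_eq]
    refine iSup₂_le fun s hs => ?_
    rw [← ha.colon_mul_eq inf_le_left]
    exact mul_le_mul' ((colon_mono inf_le_right le_rfl).trans
      (le_sSup (Set.mem_image_of_mem _ hs))) le_rfl
  have hone : 1 ≤ sSup ((fun s => colon s a) '' S) := by
    have h := ha.2 (sSup ((fun s => colon s a) '' S)) ⊥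
    rw [sup_bot_eq, colon_eq_one hle'] at h
    rw [← h]
    obtain ⟨s, hs⟩ := hne
    exact sup_le le_rfl ((colon_mono bot_le le_rfl).trans
      (le_sSup (Set.mem_image_of_mem (fun s => colon s a) hs)))
  obtain ⟨_, ⟨s, hs, rfl⟩, h⟩ := h1 _ (hne.image _) hdir' hone
  exact ⟨s, hs, by simpa using le_colon_iff.1 h⟩

/-- In a lattice domain, nonzero principal elements are cancellable. -/
theorem IsLPrincipal.le_of_mul_le_mul (hd : IsLatticeDomain L) {a x y : L} (ha : IsLPrincipal a)
    (ha0 : a ≠ ⊥) (h : x * a ≤ y * a) : x ≤ y := by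
  have h0 : colon ⊥ a = ⊥ :=
    (hd _ _ (le_bot_iff.1 (colon_mul_le ⊥ a))).resolve_right ha0
  have := ha.2 y ⊥
  rw [h0, sup_bot_eq, sup_bot_eq] at this
  rw [this]
  exact le_colon_iff.2 h

/-- In a lattice domain, factors of nonzero principal elements are cancellable. -/
theorem IsLPrincipal.le_of_mul_le_mul_of_factor (hd : IsLatticeDomain L) {x y u w : L}
    (ha : IsLPrincipal (x * y)) (ha0 : x * y ≠ ⊥) (h : u * x ≤ w * x) : u ≤ w := by
  refine ha.le_of_mul_le_mul hd ha0 ?_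
  rw [← mul_assoc, ← mul_assoc]
  exact mul_le_mul' h le_rfl

/-- In a lattice domain, factors of nonzero principal elements are principal. -/
theorem IsLPrincipal.of_mul (hd : IsLatticeDomain L) {x y : L} (ha : IsLPrincipal (x * y))
    (ha0 : x * y ≠ ⊥) : IsLPrincipal x := by
  have hcx : ∀ {u w : L}, u * x ≤ w * x → u ≤ w := ha.le_of_mul_le_mul_of_factor hd ha0
  have hcy : ∀ {u w : L}, u * y ≤ w * y → u ≤ w := fun {u w} h => by
    rw [mul_comm] at ha ha0
    exact ha.le_of_mul_le_mul_of_factor hd ha0 h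
  constructor
  · intro u z
    refine le_antisymm ?_ (le_inf ((mul_le_mul' inf_le_left le_rfl).trans (colon_mul_le _ _))
      (mul_le_mul' inf_le_right le_rfl))
    have hwx : u ⊓ z * x ≤ x := inf_le_right.trans (mul_le_right' _ _)
    have hc := ha.colon_mul_eq (mul_le_mul' hwx (le_refl y))
    rw [← mul_assoc] at hc
    have hc' : colon ((u ⊓ z * x) * y) (x * y) * x = u ⊓ z * x :=
      le_antisymm (hcy hc.le) (hcy hc.ge)
    rw [← hc']
    refine mul_le_mul' (le_inf (le_colon_iff.2 ?_) (hcx ?_)) le_rfl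
    · rw [hc']; exact inf_le_left
    · rw [hc']; exact inf_le_right
  · intro u z
    refine le_antisymm (sup_le (le_colon_iff.2 le_sup_left) (colon_mono le_sup_right le_rfl)) ?_
    set w := colon (u * x ⊔ z) x
    have hw : w * (x * y) ≤ u * (x * y) ⊔ z * y := by
      rw [← mul_assoc, ← mul_assoc, ← Quantale.sup_mul_distrib]
      exact mul_le_mul' (colon_mul_le _ _) le_rfl
    have h1 : w ≤ u ⊔ colon (z * y) (x * y) := by
      rw [ha.2]
      exact le_colon_iff.2 hw
    refine h1.trans (sup_le_sup_left (le_colon_iff.2 (hcy ?_)) _)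
    rw [mul_assoc]
    exact colon_mul_le _ _

theorem IsPrincipallyGenerated.exists_not_le (hg : IsPrincipallyGenerated L) {x y : L}
    (h : ¬ x ≤ y) : ∃ a, IsLPrincipal a ∧ a ≤ x ∧ ¬ a ≤ y := by
  obtain ⟨S, hS, rfl⟩ := hg x
  by_contra! hc
  exact h (sSup_le fun a ha => hc a (hS a ha) (le_sSup ha))

theorem IsPrincipallyGenerated.exists_ne_bot (hg : IsPrincipallyGenerated L) {x : L}
    (h : x ≠ ⊥) : ∃ a, IsLPrincipal a ∧ a ≤ x ∧ a ≠ ⊥ := by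
  obtain ⟨a, ha, hax, h0⟩ := hg.exists_not_le (mt le_bot_iff.1 h)
  exact ⟨a, ha, hax, mt le_bot_iff.2 h0⟩

theorem IsPrincipallyGenerated.eq_sSup (hg : IsPrincipallyGenerated L) (x : L) :
    x = sSup {a | IsLPrincipal a ∧ a ≤ x} := by
  obtain ⟨S, hS, hx⟩ := hg x
  refine le_antisymm ?_ (sSup_le fun a ha => ha.2)
  conv_lhs => rw [← hx]
  exact sSup_le_sSup fun a ha => ⟨hS a ha, hx ▸ le_sSup ha⟩

theorem IsPrincipallyGenerated.mul_eq_sSup (hg : IsPrincipallyGenerated L) (x y : L) :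
    x * y = sSup {w | ∃ a b, IsLPrincipal a ∧ IsLPrincipal b ∧ a ≤ x ∧ b ≤ y ∧ a * b = w} := by
  refine le_antisymm ?_ (sSup_le ?_)
  · conv_lhs => rw [hg.eq_sSup x, hg.eq_sSup y, sSup_mul_distrib]
    refine iSup₂_le fun a ha => ?_
    rw [mul_sSup_distrib]
    exact iSup₂_le fun b hb => le_sSup ⟨a, b, ha.1, hb.1, ha.2, hb.2, rfl⟩
  · rintro _ ⟨a, b, -, -, ha, hb, rfl⟩
    exact mul_le_mul' ha hb

theorem prod_ne_bot (hd : IsLatticeDomain L) {s : Multiset L} (h1 : (1 : L) ≠ ⊥)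
    (hs : ∀ a ∈ s, a ≠ ⊥) : s.prod ≠ ⊥ := by
  induction s using Multiset.induction_on with
  | empty => simpa using h1
  | cons a s ih =>
    rw [Multiset.prod_cons]
    exact fun h => (hd _ _ h).elim (hs a (by simp)) (ih fun b hb => hs b (by simp [hb]))

theorem pow_ne_bot (hd : IsLatticeDomain L) {x : L} (hx : x ≠ ⊥) (n : ℕ) : x ^ n ≠ ⊥ := by
  rw [← Multiset.prod_replicate]
  exact prod_ne_bot hd (fun h => hx (le_bot_iff.1 (h ▸ le_one' x)))
    fun a ha => Multiset.eq_of_mem_replicate ha ▸ hx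

end Basic

end MultiplicativeLattice

namespace MultiplicativeLattice

/-! ### Separation and minimal primes. -/

section LocalStructure

variable {L : Type*} [CommMonoid L] [CompleteLattice L] [IsMultiplicativeLattice L]

theorem IsCLattice.exists_not_le (hC : IsCLattice L) {x y : L} (h : ¬ x ≤ y) :
    ∃ a, IsCompactElement a ∧ a ≤ x ∧ ¬ a ≤ y := by
  have := hC.isCompactlyGenerated
  rw [le_iff_compact_le_imp] at h
  push Not at h
  exact h

theorem IsCLattice.pow_compact (hC : IsCLattice L) {x : L} (hx : IsCompactElement x) (n : ℕ) :
    IsCompactElement (x ^ n) := by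
  induction n with
  | zero => simpa using hC.one_compact
  | succ n ih => rw [pow_succ]; exact hC.mul_compact _ _ ih hx

/-- Every term in the expansion of `(a ⊔ b) ^ (i + j)` contains `a ^ i` or `b ^ j`. -/
theorem sup_pow_add_le {x a b s t : L} {i j : ℕ} (ha : s * a ^ i ≤ x) (hb : t * b ^ j ≤ x) :
    s * t * (a ⊔ b) ^ (i + j) ≤ x := by
  -- `c` collects the letters already chosen from the expanded factors.
  have main : ∀ (n i j : ℕ) (c : L), i + j = n → s * c * a ^ i ≤ x → t * c * b ^ j ≤ x →
      s * t * c * (a ⊔ b) ^ n ≤ x := by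
    intro n
    induction n with
    | zero =>
      intro i j c hij h1 h2
      obtain ⟨rfl, rfl⟩ : i = 0 ∧ j = 0 := by omega
      refine le_trans ?_ h1
      rw [mul_right_comm s t c, pow_zero, pow_zero, mul_one, mul_one]
      exact mul_le_left' _ _
    | succ n ih =>
      intro i j c hij h1 h2
      rcases Nat.eq_zero_or_pos i with rfl | hi
      · refine le_trans ?_ h1
        rw [pow_zero, mul_one, mul_right_comm s t c, mul_assoc (s * c)]
        exact mul_le_left' _ _
      rcases Nat.eq_zero_or_pos j with rfl | hj
      · refine le_trans ?_ h2
        rw [pow_zero, mul_one, mul_assoc s t c, mul_comm s, mul_assoc (t * c)]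
        exact mul_le_left' _ _
      obtain ⟨i, rfl⟩ := Nat.exists_eq_succ_of_ne_zero hi.ne'
      obtain ⟨j, rfl⟩ := Nat.exists_eq_succ_of_ne_zero hj.ne'
      have h3 := ih i (j + 1) (c * a) (by omega)
        (le_trans (le_of_eq (by rw [pow_succ']; ac_rfl)) h1)
        (le_trans (le_trans (le_of_eq (by ac_rfl)) (mul_le_left' _ a)) h2)
      have h4 := ih (i + 1) j (c * b) (by omega)
        (le_trans (le_trans (le_of_eq (by ac_rfl)) (mul_le_left' _ b)) h1)
        (le_trans (le_of_eq (by rw [pow_succ']; ac_rfl)) h2)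
      have h5 : s * t * c * (a ⊔ b) ^ (n + 1)
          = s * t * (c * a) * (a ⊔ b) ^ n ⊔ s * t * (c * b) * (a ⊔ b) ^ n := by
        rw [← Quantale.sup_mul_distrib, ← Quantale.mul_sup_distrib, ← Quantale.mul_sup_distrib,
          pow_succ']
        ac_rfl
      rw [h5]
      exact sup_le h3 h4
  simpa using main (i + j) i j 1 rfl (by simpa using ha) (by simpa using hb)

/-- `x` lies below the prime element `p`, and `p` is minimal over `x`: every compact element below
`p` has, locally at `p`, a power below `x`. -/
def IsMinimalOver (p x : L) : Prop :=
  x ≤ p ∧ ∀ a, IsCompactElement a → a ≤ p → ∃ s, ¬ s ≤ p ∧ ∃ n : ℕ, s * a ^ n ≤ x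

/-- Separation: a multiplicatively closed set of compact elements none of which lies below `x`
is avoided by some minimal prime element over `x`. -/
theorem IsCLattice.exists_prime_of_submonoid (hC : IsCLattice L) {x : L} (T : Submonoid L)
    (hT : ∀ s ∈ T, IsCompactElement s ∧ ¬ s ≤ x) :
    ∃ q, IsPrimeElement q ∧ IsMinimalOver q x ∧ ∀ s ∈ T, ¬ s ≤ q := by
  -- For a maximal such monoid `U`, every compact element outside `U` has a power that some member
  -- of `U` multiplies below `x`. The elements with this property form a directed set `N`, and its
  -- join is the prime; minimality over `x` is then built in.
  obtain ⟨U, hTU, hU⟩ := zorn_le_nonempty₀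
    {U : Submonoid L | ∀ s ∈ U, IsCompactElement s ∧ ¬ s ≤ x}
    (fun c hc hchain U hUc => by
      refine ⟨sSup c, fun s hs => ?_, fun V hV => le_sSup hV⟩
      rw [Submonoid.mem_sSup_of_directedOn ⟨U, hUc⟩ hchain.directedOn] at hs
      obtain ⟨V, hV, hsV⟩ := hs
      exact hc hV s hsV) T hT
  have hUx := hU.prop
  have hout : ∀ a, IsCompactElement a → a ∉ U → ∃ s ∈ U, ∃ n : ℕ, s * a ^ n ≤ x := by
    intro a ha haU
    by_contra! hcon
    have hmem : U ⊔ Submonoid.powers a ∈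
        {U : Submonoid L | ∀ s ∈ U, IsCompactElement s ∧ ¬ s ≤ x} := by
      intro s hs
      obtain ⟨y, hy, _, ⟨n, rfl⟩, rfl⟩ := Submonoid.mem_sup.1 hs
      exact ⟨hC.mul_compact _ _ (hUx y hy).1 (hC.pow_compact ha n), hcon y hy n⟩
    exact haU (hU.le_of_ge hmem le_sup_left
      (Submonoid.mem_sup_right (Submonoid.mem_powers a)))
  set N : Set L := {a | ∃ s ∈ U, ∃ n : ℕ, s * a ^ n ≤ x} with hN
  have hNU : ∀ a ∈ N, a ∉ U := by
    rintro a ⟨s, hs, n, hn⟩ ha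
    exact (hUx _ (U.mul_mem hs (U.pow_mem ha n))).2 hn
  have hNdir : DirectedOn (· ≤ ·) N := by
    rintro a ⟨s, hs, i, hi⟩ b ⟨t, ht, j, hj⟩
    exact ⟨a ⊔ b, ⟨s * t, U.mul_mem hs ht, i + j, sup_pow_add_le hi hj⟩, le_sup_left,
      le_sup_right⟩
  have hxN : x ∈ N := ⟨1, U.one_mem, 1, by simp⟩
  have hmemN : ∀ a, IsCompactElement a → a ≤ sSup N → a ∈ N := by
    intro a ha haN
    rw [CompleteLattice.isCompactElement_iff_le_of_directed_sSup_le] at ha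
    obtain ⟨b, ⟨s, hs, n, hn⟩, hab⟩ := ha N ⟨x, hxN⟩ hNdir haN
    exact ⟨s, hs, n, (mul_le_mul' le_rfl (pow_le_pow_left' hab n)).trans hn⟩
  have hUq : ∀ s ∈ U, ¬ s ≤ sSup N := fun s hs h => hNU s (hmemN s (hUx s hs).1 h) hs
  refine ⟨sSup N, ⟨fun h => hUq 1 U.one_mem h.ge, fun a b hab => ?_⟩, ⟨le_sSup hxN, ?_⟩,
    fun s hs => hUq s (hTU hs)⟩
  · by_contra! hcon
    obtain ⟨a', ha', haa', haN⟩ := hC.exists_not_le hcon.1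
    obtain ⟨b', hb', hbb', hbN⟩ := hC.exists_not_le hcon.2
    have hU' : ∀ c, IsCompactElement c → ¬ c ≤ sSup N → c ∈ U := fun c hc hcN => by
      by_contra hcU
      exact hcN (le_sSup (hout c hc hcU))
    exact hUq _ (U.mul_mem (hU' a' ha' haN) (hU' b' hb' hbN))
      ((mul_le_mul' haa' hbb').trans hab)
  · intro a ha haq
    obtain ⟨s, hs, n, hn⟩ := hmemN a ha haq
    exact ⟨s, hUq s hs, n, hn⟩

theorem IsCLattice.exists_minimal_prime (hC : IsCLattice L) {x p : L} (hp : IsPrimeElement p)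
    (hx : x ≤ p) : ∃ q, IsPrimeElement q ∧ IsMinimalOver q x ∧ q ≤ p := by
  obtain ⟨q, hq, hqx, hqT⟩ := hC.exists_prime_of_submonoid (x := x)
    { carrier := {s | IsCompactElement s ∧ ¬ s ≤ p}
      mul_mem' := fun ha hb => ⟨hC.mul_compact _ _ ha.1 hb.1, hp.not_mul_le ha.2 hb.2⟩
      one_mem' := ⟨hC.one_compact, hp.not_one_le⟩ }
    (fun s hs => ⟨hs.1, fun h => hs.2 (h.trans hx)⟩)
  refine ⟨q, hq, hqx, ?_⟩
  by_contra h
  obtain ⟨a, ha, haq, hap⟩ := hC.exists_not_le h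
  exact hqT a ⟨ha, hap⟩ haq

theorem IsMinimalOver.mono {p x y : L} (hp : IsPrimeElement p) (h : IsMinimalOver p x)
    (hy : y ≤ p) {k : ℕ} (hxy : x ^ k ≤ y) : IsMinimalOver p y := by
  refine ⟨hy, fun a ha hap => ?_⟩
  obtain ⟨s, hs, n, hn⟩ := h.2 a ha hap
  refine ⟨s ^ k, fun hsk => hs (hp.isLRadical.le_of_pow_le hsk), n * k, ?_⟩
  rw [pow_mul, ← mul_pow]
  exact (pow_le_pow_left' hn k).trans hxy

/-- `b` generates the prime element `p` locally at `p`. -/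
structure IsUniformizer (p b : L) : Prop where
  principal : IsLPrincipal b
  le : b ≤ p
  not_colon_le : ∀ a, IsLPrincipal a → a ≤ p → ¬ colon b a ≤ p

/-! ### Radical factoriality makes nonzero primes maximal and locally principal. -/

variable (hL : IsPrincipallyGeneratedRadicalFactorialCLatticeDomain L)
include hL

theorem principal_compact {a : L} (ha : IsLPrincipal a) : IsCompactElement a :=
  have := hL.isCLattice.isCompactlyGenerated
  ha.isCompactElement hL.isCLattice.one_compact

/-- If `b` does not generate some `a ≤ p` locally, factor `a * a ⊔ b` into radicals. One factor `r`
is below `p`; the product `t` of the others is not, since otherwise `b ≤ p * p`. As `a ≤ r`, this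
gives `t * a ≤ a * a ⊔ b`, so `t ≤ a ⊔ colon b a ≤ p`, a contradiction. -/
theorem isUniformizer_of_colon_sq_le {p b : L} (hp : IsPrimeElement p) (hb : IsLPrincipal b)
    (hbp : b ≤ p) (h : colon (p * p) b ≤ p) : IsUniformizer p b := by
  refine ⟨hb, hbp, fun a ha hap hc => ?_⟩
  obtain ⟨s, hs, hprod⟩ := hL.isRadicalFactorial (a * a ⊔ b)
  have hJ : a * a ⊔ b ≤ p := sup_le ((mul_le_left' a a).trans hap) hbp
  obtain ⟨r, hr, hrp⟩ := hp.exists_le_of_prod_le (hprod.trans_le hJ)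
  obtain ⟨t, rfl⟩ := Multiset.exists_cons_of_mem hr
  rw [Multiset.prod_cons] at hprod
  have htp : ¬ t.prod ≤ p := fun htp => by
    have : b ≤ p * p := (le_sup_right.trans hprod.ge).trans (mul_le_mul' hrp htp)
    rw [colon_eq_one this] at h
    exact hp.not_one_le h
  have har : a ≤ r := (hs r hr).le_of_pow_le (n := 2) (by
    rw [pow_two]
    exact (le_sup_left.trans hprod.ge).trans (mul_le_left' _ _))
  have h1 : t.prod ≤ a ⊔ colon b a := by
    rw [ha.2, le_colon_iff, mul_comm, ← hprod]
    exact mul_le_mul' har le_rfl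
  exact htp (h1.trans (sup_le hap hc))

/-- A nonzero principal `ℓ`-radical element is square-free. -/
theorem IsLRadical.colon_sq_le {p b r : L} (hb : IsLPrincipal b)
    (hbp : b ≤ p) (hr : IsLRadical r) (hrp : IsLPrincipal r) (hr0 : r ≠ ⊥) :
    colon (b * b) r ≤ p := by
  by_contra hcon
  obtain ⟨t, ht, htc, htp⟩ := hL.isPrincipallyGenerated.exists_not_le hcon
  have htr : t * r ≤ b * b := le_colon_iff.1 htc
  have ht0 : t ≠ ⊥ := fun h => htp (h ▸ bot_le)
  have htr0 : t * r ≠ ⊥ := fun h => (hL.isLatticeDomain _ _ h).elim ht0 hr0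
  set c := colon (t * r) (b * b)
  have hc : c * (b * b) = t * r := (hb.mul hb).colon_mul_eq htr
  -- The square of `b * c` is `c * t * r`. Once `b * c ≤ r`, cancelling `b * c` from `t * (b * c) ≤
  -- t * r = b * (b * c)` gives `t ≤ b`.
  have hbc : b * c ≤ r := hr.le_of_pow_le (n := 2) (by
    have : (b * c) ^ 2 = c * t * r := by
      rw [mul_assoc, ← hc, pow_two]
      ac_rfl
    rw [this]
    exact mul_le_right' _ _)
  have heq : b * c * b = t * r := by
    rw [← hc]
    ac_rfl
  refine htp (le_trans ?_ hbp)
  refine IsLPrincipal.le_of_mul_le_mul_of_factor hL.isLatticeDomain (x := b * c) (y := b)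
    (heq ▸ ht.mul hrp) (heq ▸ htr0) ?_
  rw [mul_comm b (b * c), heq]
  exact mul_le_mul' le_rfl hbc

theorem exists_factorization {a : L} (ha : IsLPrincipal a) (ha0 : a ≠ ⊥) :
    ∃ s : Multiset L, s.prod = a ∧ ∀ r ∈ s, IsLRadical r ∧ IsLPrincipal r ∧ r ≠ ⊥ := by
  obtain ⟨s, hs, rfl⟩ := hL.isRadicalFactorial a
  refine ⟨s, rfl, fun r hr => ?_⟩
  obtain ⟨t, rfl⟩ := Multiset.exists_cons_of_mem hr
  rw [Multiset.prod_cons] at ha ha0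
  exact ⟨hs r hr, ha.of_mul hL.isLatticeDomain ha0, fun h => ha0 (by rw [h, bot_mul'])⟩

theorem IsPrimeElement.exists_radical_principal_le {q : L} (hq : IsPrimeElement q) (hq0 : q ≠ ⊥) :
    ∃ r, IsLRadical r ∧ IsLPrincipal r ∧ r ≠ ⊥ ∧ r ≤ q := by
  obtain ⟨a, ha, haq, ha0⟩ := hL.isPrincipallyGenerated.exists_ne_bot hq0
  obtain ⟨s, rfl, hs⟩ := exists_factorization hL ha ha0
  obtain ⟨r, hr, hrq⟩ := hq.exists_le_of_prod_le haq
  exact ⟨r, (hs r hr).1, (hs r hr).2.1, (hs r hr).2.2, hrq⟩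

/-- A radical principal element below `p` is itself a local generator of `p`. -/
theorem IsUniformizer.exists_mul_eq_mul {p b r : L} (hp : IsPrimeElement p) (hb : IsUniformizer p b)
    (hr : IsLRadical r) (hrp : IsLPrincipal r) (hr0 : r ≠ ⊥) (hrle : r ≤ p) :
    ∃ t c, IsLPrincipal t ∧ ¬ t ≤ p ∧ ¬ c ≤ p ∧ t * r = c * b := by
  obtain ⟨t, ht, htc, htp⟩ :=
    hL.isPrincipallyGenerated.exists_not_le (hb.not_colon_le r hrp hrle)
  have ht0 : t ≠ ⊥ := fun h => htp (h ▸ bot_le)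
  have htr0 : t * r ≠ ⊥ := fun h => (hL.isLatticeDomain _ _ h).elim ht0 hr0
  set c := colon (t * r) b
  have hc : c * b = t * r := hb.principal.colon_mul_eq (le_colon_iff.1 htc)
  refine ⟨t, c, ht, htp, fun hcp => ?_, hc.symm⟩
  have hcpr : IsLPrincipal c := IsLPrincipal.of_mul hL.isLatticeDomain (y := b)
    (hc ▸ ht.mul hrp) (hc ▸ htr0)
  -- If `c ≤ p`, then `c` is locally below `b`, so `r` is locally below `b * b`, contradicting
  -- square-freeness.
  refine hp.not_mul_le htp (hb.not_colon_le c hcpr hcp) (le_trans ?_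
    (IsLRadical.colon_sq_le hL hb.principal hb.le hr hrp hr0))
  rw [le_colon_iff]
  calc t * colon b c * r = colon b c * c * b := by rw [mul_assoc _ c b, hc]; ac_rfl
    _ ≤ b * b := mul_le_mul' (colon_mul_le _ _) le_rfl

/-- A nonzero `q` contains a radical principal element, which agrees with `b` up to factors outside
`p`. Hence `b ≤ q`, and `b` generates `p` locally. -/
theorem IsUniformizer.eq_of_prime_le {p b q : L} (hp : IsPrimeElement p) (hb : IsUniformizer p b)
    (hq : IsPrimeElement q) (hq0 : q ≠ ⊥) (hqp : q ≤ p) : q = p := by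
  obtain ⟨r, hr, hrp, hr0, hrq⟩ := hq.exists_radical_principal_le hL hq0
  obtain ⟨t, c, -, -, hc, h⟩ := hb.exists_mul_eq_mul hL hp hr hrp hr0 (hrq.trans hqp)
  have hbq : b ≤ q := (hq.le_or_le c b (h ▸ (mul_le_right' t r).trans hrq)).resolve_left
    fun hcq => hc (hcq.trans hqp)
  refine le_antisymm hqp ?_
  by_contra hcon
  obtain ⟨a, ha, hap, haq⟩ := hL.isPrincipallyGenerated.exists_not_le hcon
  have := (hq.le_or_le (colon b a) a ((colon_mul_le b a).trans hbq)).resolve_right haq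
  exact hb.not_colon_le a ha hap (this.trans hqp)

/-- Without a uniformizer, `p` is locally idempotent. By minimality every radical factor of `y`
locally contains `p`; by idempotence so does their product `y`, contrary to the choice of `a`. -/
theorem IsMinimalOver.exists_isUniformizer {p y a : L} (hp : IsPrimeElement p)
    (h : IsMinimalOver p y) (ha : IsLPrincipal a) (hap : a ≤ p) (hya : colon y a ≤ p) :
    ∃ b, IsUniformizer p b := by
  by_contra! hcon
  have hidem : ∀ b, IsLPrincipal b → b ≤ p → ¬ colon (p * p) b ≤ p := fun b hb hbp hc =>
    hcon b (isUniformizer_of_colon_sq_le hL hp hb hbp hc)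
  obtain ⟨s, hs, rfl⟩ := hL.isRadicalFactorial y
  have hs' : ∀ r ∈ s, ∀ a, IsLPrincipal a → a ≤ p → ¬ colon r a ≤ p := by
    intro r hr a ha hap hc
    obtain ⟨u, hu, n, hn⟩ := h.2 a (principal_compact hL ha) hap
    refine hu (le_trans (le_colon_iff.2 ((hs r hr).le_of_pow_le (n := n + 1) ?_)) hc)
    have h1 : (u * a) ^ (n + 1) = u * a ^ n * (u ^ n * a) := by
      rw [mul_pow, pow_succ, pow_succ]
      ac_rfl
    obtain ⟨t, rfl⟩ := Multiset.exists_cons_of_mem hr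
    rw [Multiset.prod_cons] at hn
    rw [h1]
    exact (mul_le_left' _ _).trans (hn.trans (mul_le_left' _ _))
  have hprod : ∀ t ≤ s, ∀ a, IsLPrincipal a → a ≤ p → ¬ colon t.prod a ≤ p := by
    intro t
    induction t using Multiset.induction_on with
    | empty =>
      intro _ a _ _
      rw [Multiset.prod_zero, colon_eq_one (le_one' a)]
      exact hp.not_one_le
    | cons r t ih =>
      intro hts a ha hap
      rw [Multiset.prod_cons]
      have ih' := ih ((Multiset.le_cons_self t r).trans hts)
      obtain ⟨u, hu, huc, hup⟩ := hL.isPrincipallyGenerated.exists_not_le (hidem a ha hap)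
      have hua : u * a ≤ p * p := le_colon_iff.1 huc
      rw [hL.isPrincipallyGenerated.mul_eq_sSup p p] at hua
      -- Locally `a` lies in `p * p`: one copy of `p` is absorbed by `r`, the other by the remaining
      -- factors.
      have h2 : ¬ colon (r * t.prod) (u * a) ≤ p := by
        refine hp.not_colon_le_of_le_sSup (principal_compact hL (hu.mul ha)) hua ?_
        rintro _ ⟨c, d, hc, hd, hcp, hdp, rfl⟩ hle
        exact hp.not_mul_le (hs' r (Multiset.mem_of_le hts (by simp)) c hc hcp) (ih' d hd hdp)
          ((colon_mul_colon_le _ _ _ _).trans hle)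
      refine fun hle => hp.not_mul_le h2 hup (le_trans ?_ hle)
      rw [le_colon_iff, mul_assoc]
      exact colon_mul_le _ _
  exact hprod s le_rfl a ha hap hya

/-- Every nonzero maximal element is locally principal. -/
theorem exists_isUniformizer {m : L} (hm : IsCoatom m) (hm0 : m ≠ ⊥) :
    ∃ b, IsUniformizer m b := by
  have hmp := isPrimeElement_of_isCoatom hm
  have hC := hL.isCLattice
  obtain ⟨x, hx, hxm, hx0⟩ := hL.isPrincipallyGenerated.exists_ne_bot hm0
  obtain ⟨q, hq, hqx, hqm⟩ := hC.exists_minimal_prime hmp hxm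
  have hqu : ∃ b, IsUniformizer q b := by
    -- Cancelling `x` gives `colon (x * x) x ≤ x ≤ q`, so `x` is not locally below its square.
    refine (hqx.mono hq (y := x * x) ((mul_le_left' x x).trans hqx.1) (k := 2)
      (pow_two x).le).exists_isUniformizer hL hq hx hqx.1 ?_
    refine le_trans (hx.le_of_mul_le_mul hL.isLatticeDomain hx0 (colon_mul_le _ _)) hqx.1
  suffices q = m from this ▸ hqu
  refine le_antisymm hqm ?_
  by_contra hcon
  obtain ⟨b, hb, hbm, hbq⟩ := hL.isPrincipallyGenerated.exists_not_le hcon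
  obtain ⟨q', hq', hq'x, hq'm⟩ := hC.exists_minimal_prime hmp (sup_le hqm hbm)
  have hbq' : b ≤ q' := le_sup_right.trans hq'x.1
  have hqq' : q ≤ q' := le_sup_left.trans hq'x.1
  -- Here `colon (q ⊔ b * b) b = b ⊔ colon q b ≤ q'`. A uniformizer of `q'` then forbids the nonzero
  -- prime `q` strictly below it.
  obtain ⟨c, hc⟩ : ∃ c, IsUniformizer q' c := by
    refine (hq'x.mono hq' (y := q ⊔ b * b) (k := 2)
      (sup_le hqq' ((mul_le_left' b b).trans hbq')) ?_).exists_isUniformizer hL hq' hb hbq' ?_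
    · rw [pow_two, Quantale.mul_sup_distrib, Quantale.sup_mul_distrib (z := b)]
      exact sup_le ((mul_le_right' _ _).trans le_sup_left)
        (sup_le ((mul_le_left' _ _).trans le_sup_left) le_sup_right)
    · rw [sup_comm, ← hb.2]
      refine sup_le hbq' (le_trans ?_ hqq')
      exact (hq.le_or_le _ _ (colon_mul_le q b)).resolve_right hbq
  have hq0 : q ≠ ⊥ := fun h => hx0 (le_bot_iff.1 (h ▸ hqx.1))
  exact hbq ((hc.eq_of_prime_le hL hq' hq hq0 hqq') ▸ hbq')

theorem exists_coatom_ge {x : L} (hx : x ≠ 1) : ∃ m, IsCoatom m ∧ x ≤ m := by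
  have h1 : IsCompactElement (⊤ : L) :=
    IsMultiplicativeLattice.one_eq_top (L := L) ▸ hL.isCLattice.one_compact
  have := CompleteLattice.coatomic_of_top_compact h1
  exact (eq_top_or_exists_le_coatom x).resolve_left
    fun h => hx (h.trans IsMultiplicativeLattice.one_eq_top.symm)

theorem IsPrimeElement.isCoatom {q : L} (hq : IsPrimeElement q) (hq0 : q ≠ ⊥) : IsCoatom q := by
  obtain ⟨m, hm, hqm⟩ := exists_coatom_ge hL hq.ne_one
  obtain ⟨b, hb⟩ := exists_isUniformizer hL hm fun h => hq0 (le_bot_iff.1 (h ▸ hqm))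
  rwa [hb.eq_of_prime_le hL (isPrimeElement_of_isCoatom hm) hq hq0 hqm]

end LocalStructure

end MultiplicativeLattice

namespace MultiplicativeLattice

/-! ### Multiplicities at maximal elements. -/

section Multiplicity

theorem isOpen_V {α : Type*} [CompleteLattice α] {x : α} (hx : IsCompactElement x) :
    IsOpen (V x) :=
  TopologicalSpace.isOpen_generateFrom_of_mem ⟨x, hx, rfl⟩

variable {L : Type*} [CommMonoid L] [CompleteLattice L] [IsMultiplicativeLattice L]

/-- The multiplicity of `x` at `m`: the largest `n` with `x ≤ m ^ n`, if there is one. -/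
noncomputable def multiplicity (m x : L) : ℕ := sInf {n | ¬ x ≤ m ^ (n + 1)}

theorem multiplicity_eq {m x : L} {n : ℕ} (h : x ≤ m ^ n) (h' : ¬ x ≤ m ^ (n + 1)) :
    multiplicity m x = n := by
  refine le_antisymm (Nat.sInf_le h') (le_csInf ⟨n, h'⟩ fun k hk => ?_)
  by_contra! hlt
  exact hk (h.trans (pow_le_pow_of_le_one' m hlt))

variable (hL : IsPrincipallyGeneratedRadicalFactorialCLatticeDomain L)
include hL

theorem IsUniformizer.ne_bot {m b : L} (hm0 : m ≠ ⊥) (hb : IsUniformizer m b) : b ≠ ⊥ := by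
  rintro rfl
  obtain ⟨a, ha, ham, ha0⟩ := hL.isPrincipallyGenerated.exists_ne_bot hm0
  refine hb.not_colon_le a ha ham ?_
  rw [(hL.isLatticeDomain _ _ (le_bot_iff.1 (colon_mul_le ⊥ a))).resolve_right ha0]
  exact bot_le

theorem IsUniformizer.not_colon_pow_le {m b w : L} (hm : IsPrimeElement m)
    (hb : IsUniformizer m b) (n : ℕ) (hw : IsLPrincipal w) (hwm : w ≤ m ^ n) :
    ¬ colon (b ^ n) w ≤ m := by
  induction n generalizing w with
  | zero =>
    rw [pow_zero, colon_eq_one (le_one' w)]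
    exact hm.not_one_le
  | succ n ih =>
    rw [pow_succ, hL.isPrincipallyGenerated.mul_eq_sSup] at hwm
    refine hm.not_colon_le_of_le_sSup (principal_compact hL hw) hwm ?_
    rintro _ ⟨c, d, hc, hd, hcm, hdm, rfl⟩ hle
    refine hm.not_mul_le (ih hc hcm) (hb.not_colon_le d hd hdm) (le_trans ?_ hle)
    rw [pow_succ]
    exact colon_mul_colon_le _ _ _ _

/-- Otherwise `b ^ n` would be locally below `b ^ (n + 1)`, and cancelling `b ^ n` would put an
element outside `m` below `b`. -/
theorem IsUniformizer.le_of_not_colon_le {m b x : L} (hm : IsPrimeElement m) (hm0 : m ≠ ⊥)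
    (hb : IsUniformizer m b) {k n : ℕ} (hx : x ≤ m ^ k) (hxb : ¬ colon x (b ^ n) ≤ m) :
    k ≤ n := by
  by_contra! hlt
  obtain ⟨t, ht, htc, htm⟩ := hL.isPrincipallyGenerated.exists_not_le hxb
  have h1 : t * b ^ n ≤ m ^ (n + 1) :=
    (le_colon_iff.1 htc).trans (hx.trans (pow_le_pow_of_le_one' m hlt))
  have h2 := hb.not_colon_pow_le hL hm (n + 1) (ht.mul (hb.principal.pow n)) h1
  refine hm.not_mul_le h2 htm (le_trans ?_ hb.le)
  refine (hb.principal.pow n).le_of_mul_le_mul hL.isLatticeDomain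
    (pow_ne_bot hL.isLatticeDomain (hb.ne_bot hL hm0) n) ?_
  rw [mul_assoc, ← pow_succ']
  exact colon_mul_le _ _

/-- In a factorization into radical principal elements, each factor below `m` contributes one `b`
locally, and the others contribute none. -/
theorem IsUniformizer.exists_pow_principal {m b a : L} (hm : IsPrimeElement m)
    (hb : IsUniformizer m b) (ha : IsLPrincipal a) (ha0 : a ≠ ⊥) :
    ∃ n, a ≤ m ^ n ∧ ¬ colon a (b ^ n) ≤ m := by
  obtain ⟨s, rfl, hs⟩ := exists_factorization hL ha ha0
  clear ha ha0
  induction s using Multiset.induction_on with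
  | empty =>
    refine ⟨0, by simp, ?_⟩
    rw [Multiset.prod_zero, pow_zero, colon_one]
    exact hm.not_one_le
  | cons r s ih =>
    obtain ⟨n, hn, hn'⟩ := ih fun r hr => hs r (by simp [hr])
    obtain ⟨hr, hrp, hr0⟩ := hs r (by simp)
    rw [Multiset.prod_cons]
    obtain ⟨k, hk, hk'⟩ : ∃ k, r ≤ m ^ k ∧ ¬ colon r (b ^ k) ≤ m := by
      by_cases hrm : r ≤ m
      · refine ⟨1, by simpa using hrm, fun hle => ?_⟩
        obtain ⟨t, c, -, -, hc, h⟩ := hb.exists_mul_eq_mul hL hm hr hrp hr0 hrm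
        refine hc (le_trans ?_ hle)
        rw [le_colon_iff, pow_one, ← h]
        exact mul_le_right' _ _
      · exact ⟨0, by simpa using le_one' r, by simpa [colon_one] using hrm⟩
    refine ⟨k + n, ?_, fun hle => hm.not_mul_le hk' hn' (le_trans ?_ hle)⟩
    · rw [pow_add]
      exact mul_le_mul' hk hn
    · rw [pow_add]
      exact colon_mul_colon_le _ _ _ _

theorem IsUniformizer.multiplicity_eq_of_not_colon_le {m b x : L} (hm : IsPrimeElement m)
    (hm0 : m ≠ ⊥) (hb : IsUniformizer m b) {n : ℕ} (hx : x ≤ m ^ n)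
    (hxb : ¬ colon x (b ^ n) ≤ m) : multiplicity m x = n :=
  multiplicity_eq hx fun h => Nat.not_succ_le_self n (hb.le_of_not_colon_le hL hm hm0 h hxb)

theorem IsUniformizer.multiplicity_spec {m b x : L} (hm : IsPrimeElement m)
    (hm0 : m ≠ ⊥) (hb : IsUniformizer m b) (hx0 : x ≠ ⊥) :
    x ≤ m ^ multiplicity m x ∧ ¬ colon x (b ^ multiplicity m x) ≤ m := by
  classical
  have hex : ∃ n, ¬ colon x (b ^ n) ≤ m := by
    obtain ⟨a, ha, hax, ha0⟩ := hL.isPrincipallyGenerated.exists_ne_bot hx0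
    obtain ⟨n, -, hn⟩ := hb.exists_pow_principal hL hm ha ha0
    exact ⟨n, fun h => hn ((colon_mono hax le_rfl).trans h)⟩
  -- Each nonzero principal element below `x` has its own exponent, at least the minimal one.
  have hle : x ≤ m ^ Nat.find hex := by
    by_contra hcon
    obtain ⟨a, ha, hax, ham⟩ := hL.isPrincipallyGenerated.exists_not_le hcon
    obtain ⟨k, hk, hk'⟩ := hb.exists_pow_principal hL hm ha fun h => ham (h ▸ bot_le)
    exact ham (hk.trans (pow_le_pow_of_le_one' m
      (Nat.find_min' hex fun h => hk' ((colon_mono hax le_rfl).trans h))))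
  rw [hb.multiplicity_eq_of_not_colon_le hL hm hm0 hle (Nat.find_spec hex)]
  exact ⟨hle, Nat.find_spec hex⟩

/-- `⊥` must be excluded: it lies below all powers of `m`, yet its multiplicity is `sInf ∅ = 0`. -/
theorem le_multiplicity_iff {m x : L} (hm : IsCoatom m) (hm0 : m ≠ ⊥) (hx0 : x ≠ ⊥) {n : ℕ} :
    n ≤ multiplicity m x ↔ x ≤ m ^ n := by
  have hmp := isPrimeElement_of_isCoatom hm
  obtain ⟨b, hb⟩ := exists_isUniformizer hL hm hm0
  obtain ⟨h1, h2⟩ := hb.multiplicity_spec hL hmp hm0 hx0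
  exact ⟨fun h => h1.trans (pow_le_pow_of_le_one' m h),
    fun h => hb.le_of_not_colon_le hL hmp hm0 h h2⟩

theorem multiplicity_mul {m x y : L} (hm : IsCoatom m) (hm0 : m ≠ ⊥) (hx0 : x ≠ ⊥)
    (hy0 : y ≠ ⊥) : multiplicity m (x * y) = multiplicity m x + multiplicity m y := by
  have hmp := isPrimeElement_of_isCoatom hm
  obtain ⟨b, hb⟩ := exists_isUniformizer hL hm hm0
  obtain ⟨h1, h2⟩ := hb.multiplicity_spec hL hmp hm0 hx0
  obtain ⟨h3, h4⟩ := hb.multiplicity_spec hL hmp hm0 hy0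
  refine hb.multiplicity_eq_of_not_colon_le hL hmp hm0 ?_ fun hle =>
    hmp.not_mul_le h2 h4 (le_trans ?_ hle)
  · rw [pow_add]
    exact mul_le_mul' h1 h3
  · rw [pow_add]
    exact colon_mul_colon_le _ _ _ _

theorem IsLRadical.multiplicity_eq_one {m r : L} (hm : IsCoatom m) (hm0 : m ≠ ⊥)
    (hr : IsLRadical r) (hr0 : r ≠ ⊥) (hrm : r ≤ m) : multiplicity m r = 1 := by
  have hmp := isPrimeElement_of_isCoatom hm
  obtain ⟨b, hb⟩ := exists_isUniformizer hL hm hm0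
  obtain ⟨-, h2⟩ := hb.multiplicity_spec hL hmp hm0 hr0
  refine hb.multiplicity_eq_of_not_colon_le hL hmp hm0 (by simpa using hrm) fun hle =>
    h2 (le_trans ?_ hle)
  set n := multiplicity m r
  rw [pow_one, le_colon_iff]
  -- The exponent `n + 1` leaves a factor `colon r (b ^ n) * b ^ n ≤ r` even when `n = 0`.
  refine hr.le_of_pow_le (n := n + 1) ?_
  have : (colon r (b ^ n) * b) ^ (n + 1)
      = colon r (b ^ n) * b ^ n * (colon r (b ^ n) ^ n * b) := by
    rw [mul_pow, pow_succ, pow_succ]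
    ac_rfl
  rw [this]
  exact (mul_le_left' _ _).trans (colon_mul_le _ _)

theorem multiplicity_eq_zero {m x : L} (hm : IsCoatom m) (hm0 : m ≠ ⊥) (hx0 : x ≠ ⊥)
    (hxm : ¬ x ≤ m) : multiplicity m x = 0 := by
  by_contra h
  exact hxm (by simpa using (le_multiplicity_iff hL hm hm0 hx0).1 (Nat.one_le_iff_ne_zero.2 h))

theorem eq_bot_of_isEmpty_maxSpace [hE : IsEmpty (MaxSpace L)] (x : L) : x = ⊥ := by
  have h1 : (⊥ : L) = 1 := by
    by_contra h1
    obtain ⟨m, hm, -⟩ := exists_coatom_ge hL h1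
    exact hE.false ⟨m, hm⟩
  exact le_bot_iff.1 (h1 ▸ le_one' x)

theorem le_iff_multiplicity_le (h0 : ¬ IsCoatom (⊥ : L)) {x y : L} (hx0 : x ≠ ⊥) (hy0 : y ≠ ⊥) :
    x ≤ y ↔ ∀ m : MaxSpace L, multiplicity m.1 y ≤ multiplicity m.1 x := by
  have hne : ∀ {m : L}, IsCoatom m → m ≠ ⊥ := fun hm h => h0 (h ▸ hm)
  constructor
  · intro h m
    rw [le_multiplicity_iff hL m.2 (hne m.2) hx0]
    exact h.trans ((le_multiplicity_iff hL m.2 (hne m.2) hy0).1 le_rfl)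
  · intro h
    by_contra hcon
    obtain ⟨a, ha, hax, hay⟩ := hL.isPrincipallyGenerated.exists_not_le hcon
    -- At this `m`, `a` is locally below `b ^ multiplicity m y`, which is locally below `y`.
    obtain ⟨m, hm, hle⟩ := exists_coatom_ge hL (x := colon y a)
      fun h1 => hay (by simpa using le_colon_iff.1 h1.ge)
    have hmp := isPrimeElement_of_isCoatom hm
    obtain ⟨b, hb⟩ := exists_isUniformizer hL hm (hne hm)
    obtain ⟨-, h2⟩ := hb.multiplicity_spec hL hmp (hne hm) hy0
    have ham : a ≤ m ^ multiplicity m y :=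
      hax.trans ((le_multiplicity_iff hL hm (hne hm) hx0).1 (h ⟨m, hm⟩))
    exact hmp.not_mul_le h2 (hb.not_colon_pow_le hL hmp _ ha ham)
      ((colon_mul_colon_le_colon _ _ _).trans hle)

/-! ### Compact sets of maximal elements and realization of multiplicity functions. -/

/-- By Alexander's subbasis theorem, covers by sets `V y` suffice. Without a finite subcover, no
product of the `y` is below `z`, so a prime over `z` avoids them all. It is nonzero, hence maximal:
an uncovered point. -/
theorem isCompact_V {z : L} (hz : z ≠ ⊥) : IsCompact (V z) := by
  refine isCompact_generateFrom rfl fun P hP hcover => ?_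
  by_contra! hcon
  have hcon' : ∀ T : Multiset L, (∀ y ∈ T, IsCompactElement y ∧ V y ∈ P) → ¬ T.prod ≤ z := by
    classical
    intro T hT hle
    have hQ : V '' {y | y ∈ T.toFinset} ⊆ P := by
      rintro _ ⟨y, hy, rfl⟩
      exact (hT y (by simpa using hy)).2
    refine hcon _ hQ ((Finset.finite_toSet _).image _) fun m hm => ?_
    obtain ⟨y, hy, hym⟩ :=
      (isPrimeElement_of_isCoatom m.2).exists_le_of_prod_le (hle.trans (show z ≤ m.1 from hm))
    exact ⟨V y, ⟨y, by simpa using hy, rfl⟩, hym⟩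
  obtain ⟨q, hq, hqz, hqT⟩ := hL.isCLattice.exists_prime_of_submonoid (x := z)
    (Submonoid.closure {y | IsCompactElement y ∧ V y ∈ P}) (fun s hs => by
      obtain ⟨T, hT, rfl⟩ := Submonoid.exists_multiset_of_mem_closure hs
      refine ⟨?_, hcon' T hT⟩
      clear hs
      induction T using Multiset.induction_on with
      | empty => simpa using hL.isCLattice.one_compact
      | cons a T ih =>
        rw [Multiset.prod_cons]
        exact hL.isCLattice.mul_compact _ _ (hT a (by simp)).1 (ih fun y hy => hT y (by simp [hy])))
  have hqm := hq.isCoatom hL fun h => hz (le_bot_iff.1 (h ▸ hqz.1))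
  obtain ⟨U, hU, hmU⟩ := hcover (show (⟨q, hqm⟩ : MaxSpace L) ∈ V z from hqz.1)
  obtain ⟨y, hy, rfl⟩ := hP hU
  exact hqT y (Submonoid.subset_closure ⟨hy, hU⟩) hmU

theorem exists_V_eq [Nontrivial L] (h0 : ¬ IsCoatom (⊥ : L)) {K : Set (MaxSpace L)}
    (hK : IsCompact K) : ∃ r : L, r ≠ ⊥ ∧ IsLRadical r ∧ V r = K := by
  have h10 : (1 : L) ≠ ⊥ := IsMultiplicativeLattice.one_eq_top (L := L) ▸ top_ne_bot
  -- `r` is the meet of `K`. Nonzero values of `g` show `r ≠ ⊥`; values not below a given `m ∉ K`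
  -- show that `r` is not below `m`.
  have key : ∀ g : MaxSpace L → L, (∀ m ∈ K, IsCompactElement (g m) ∧ g m ≤ m.1) →
      ∃ t : Finset (MaxSpace L), (∀ i ∈ t, i ∈ K) ∧
        (t.val.map g).prod ≤ sInf (Subtype.val '' K : Set L) := by
    intro g hg
    obtain ⟨t, htK, ht⟩ := hK.elim_nhds_subcover (fun m => V (g m)) fun m hm =>
      (isOpen_V (hg m hm).1).mem_nhds (hg m hm).2
    refine ⟨t, htK, le_sInf ?_⟩
    rintro _ ⟨m, hm, rfl⟩
    obtain ⟨i, hi, hmi⟩ := Set.mem_iUnion₂.1 (ht hm)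
    obtain ⟨u, hu⟩ := Multiset.exists_cons_of_mem (Multiset.mem_map_of_mem g hi)
    rw [hu, Multiset.prod_cons]
    exact (mul_le_left' _ _).trans hmi
  have hr : IsLRadical (sInf (Subtype.val '' K : Set L)) := by
    refine le_antisymm (le_lRadical _) (sSup_le ?_)
    rintro y ⟨n, -, hn⟩
    refine le_sInf ?_
    rintro _ ⟨m, hm, rfl⟩
    exact (isPrimeElement_of_isCoatom m.2).isLRadical.le_of_pow_le
      (hn.trans (sInf_le ⟨m, hm, rfl⟩))
  refine ⟨_, ?_, hr, ?_⟩
  · have hex : ∀ m ∈ K, ∃ y : L, (IsCompactElement y ∧ y ≤ m.1) ∧ y ≠ ⊥ := by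
      intro m _
      obtain ⟨a, ha, ham, ha0⟩ := hL.isPrincipallyGenerated.exists_ne_bot
        (x := m.1) fun h => h0 (h ▸ m.2)
      exact ⟨a, ⟨principal_compact hL ha, ham⟩, ha0⟩
    choose! g hg hg0 using hex
    obtain ⟨t, htK, ht⟩ := key g hg
    refine fun h => prod_ne_bot hL.isLatticeDomain h10 (s := t.val.map g) ?_
      (le_bot_iff.1 (h ▸ ht))
    intro a ha
    obtain ⟨i, hi, rfl⟩ := Multiset.mem_map.1 ha
    exact hg0 i (htK i hi)
  · refine Set.Subset.antisymm (fun m hm => ?_) fun m hm => sInf_le ⟨m, hm, rfl⟩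
    by_contra hmK
    have hex : ∀ i ∈ K, ∃ y : L, (IsCompactElement y ∧ y ≤ i.1) ∧ ¬ y ≤ m.1 := by
      intro i hi
      have hnle : ¬ i.1 ≤ m.1 := fun hle => by
        rcases hle.eq_or_lt with h | h
        · exact hmK (Subtype.ext h ▸ hi)
        · exact m.2.1 (i.2.2 _ h)
      obtain ⟨y, hy, hyi, hym⟩ := hL.isCLattice.exists_not_le hnle
      exact ⟨y, ⟨hy, hyi⟩, hym⟩
    choose! g hg hgm using hex
    obtain ⟨t, htK, ht⟩ := key g hg
    obtain ⟨a, ha, ham⟩ :=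
      (isPrimeElement_of_isCoatom m.2).exists_le_of_prod_le (ht.trans hm)
    obtain ⟨i, hi, rfl⟩ := Multiset.mem_map.1 ha
    exact hgm i (htK i hi) ham

/-- The functions that occur as families of multiplicities. -/
def IsMultiplicityFunction {X : Type*} [TopologicalSpace X] (f : X → ℕ) : Prop :=
  (∃ N, ∀ m, f m ≤ N) ∧ ∀ n, 1 ≤ n → IsCompact {m | n ≤ f m}

theorem isMultiplicityFunction_multiplicity (h0 : ¬ IsCoatom (⊥ : L)) {x : L} (hx0 : x ≠ ⊥) :
    IsMultiplicityFunction fun m : MaxSpace L => multiplicity m.1 x := by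
  have hne : ∀ {m : L}, IsCoatom m → m ≠ ⊥ := fun hm h => h0 (h ▸ hm)
  obtain ⟨s, hs, rfl⟩ := hL.isRadicalFactorial x
  -- The superlevel sets are tracked as sets `V z`, where intersections become joins and unions
  -- become products. Level `0` is the whole space `V ⊥`, so `z ≠ ⊥` is asked only from level `1`
  -- on.
  suffices h : (∃ N, ∀ m : MaxSpace L, multiplicity m.1 s.prod ≤ N) ∧
      ∀ n, ∃ z : L, (1 ≤ n → z ≠ ⊥) ∧ V z = {m : MaxSpace L | n ≤ multiplicity m.1 s.prod} by
    refine ⟨h.1, fun n hn => ?_⟩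
    obtain ⟨z, hz, hV⟩ := h.2 n
    rw [← hV]
    exact isCompact_V hL (hz hn)
  induction s using Multiset.induction_on with
  | empty =>
    have h10 : (1 : L) ≠ ⊥ := by simpa using hx0
    have hone : ∀ m : MaxSpace L, multiplicity m.1 (Multiset.prod (0 : Multiset L)) = 0 := fun m =>
      multiplicity_eq_zero hL m.2 (hne m.2) hx0
        (by simpa using (isPrimeElement_of_isCoatom m.2).not_one_le)
    refine ⟨⟨0, fun m => (hone m).le⟩, fun n => ?_⟩
    rcases Nat.eq_zero_or_pos n with rfl | hn
    · exact ⟨⊥, by simp, by ext m; simp [V]⟩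
    · refine ⟨1, fun _ => h10, ?_⟩
      ext m
      simp only [V, Set.mem_ofPred_eq, hone]
      exact ⟨fun h => absurd h (isPrimeElement_of_isCoatom m.2).not_one_le, fun h => by omega⟩
  | cons r s ih =>
    rw [Multiset.prod_cons] at hx0 ⊢
    have hr0 : r ≠ ⊥ := fun h => hx0 (by rw [h, bot_mul'])
    have hs0 : s.prod ≠ ⊥ := fun h => hx0 (by rw [h, mul_bot'])
    have hr : IsLRadical r := hs r (by simp)
    obtain ⟨⟨N, hN⟩, hV⟩ := ih (fun a ha => hs a (by simp [ha])) hs0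
    have hmul : ∀ m : MaxSpace L, multiplicity m.1 (r * s.prod) =
        multiplicity m.1 r + multiplicity m.1 s.prod := fun m =>
      multiplicity_mul hL m.2 (hne m.2) hr0 hs0
    have h1 : ∀ m : MaxSpace L, r ≤ m.1 → multiplicity m.1 r = 1 := fun m h =>
      hr.multiplicity_eq_one hL m.2 (hne m.2) hr0 h
    have h2 : ∀ m : MaxSpace L, ¬ r ≤ m.1 → multiplicity m.1 r = 0 := fun m h =>
      multiplicity_eq_zero hL m.2 (hne m.2) hr0 h
    refine ⟨⟨N + 1, fun m => ?_⟩, fun n => ?_⟩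
    · rw [hmul]
      have := hN m
      by_cases h : r ≤ m.1
      · rw [h1 m h]; omega
      · rw [h2 m h]; omega
    rcases n with _ | n
    · exact ⟨⊥, by simp, by ext m; simp [V]⟩
    obtain ⟨z, -, hz⟩ := hV n
    obtain ⟨z', hz'0, hz'⟩ := hV (n + 1)
    have hrz : r ⊔ z ≠ ⊥ := fun h => hr0 (le_bot_iff.1 (h ▸ le_sup_left))
    -- Level `n + 1` is reached either at level `n` of `s.prod` together with `r ≤ m`, or at level
    -- `n + 1` of `s.prod` alone.
    refine ⟨(r ⊔ z) * z', fun _ h => (hL.isLatticeDomain _ _ h).elim hrz (hz'0 (by omega)), ?_⟩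
    ext m
    have e1 : z ≤ m.1 ↔ n ≤ multiplicity m.1 s.prod := Set.ext_iff.1 hz m
    have e2 : z' ≤ m.1 ↔ n + 1 ≤ multiplicity m.1 s.prod := Set.ext_iff.1 hz' m
    have e3 : (r ⊔ z) * z' ≤ m.1 ↔ r ⊔ z ≤ m.1 ∨ z' ≤ m.1 :=
      ⟨(isPrimeElement_of_isCoatom m.2).le_or_le _ _, fun h => h.elim
        (mul_le_left' _ _).trans (mul_le_right' _ _).trans⟩
    change (r ⊔ z) * z' ≤ m.1 ↔ n + 1 ≤ multiplicity m.1 (r * s.prod)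
    rw [e3, sup_le_iff, e1, e2, hmul]
    by_cases h : r ≤ m.1
    · rw [h1 m h]; simp only [h, true_and]; omega
    · rw [h2 m h]; simp only [h, false_and, false_or]; omega

/-- The element is built in layers: each compact superlevel set is `V r` for a radical `r`, which
adds one exactly there. Boundedness ends the process. -/
theorem IsMultiplicityFunction.exists_multiplicity_eq [Nontrivial L] (h0 : ¬ IsCoatom (⊥ : L))
    {f : MaxSpace L → ℕ} (hf : IsMultiplicityFunction f) :
    ∃ x : L, x ≠ ⊥ ∧ ∀ m : MaxSpace L, multiplicity m.1 x = f m := by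
  have hne : ∀ {m : L}, IsCoatom m → m ≠ ⊥ := fun hm h => h0 (h ▸ hm)
  have h10 : (1 : L) ≠ ⊥ := IsMultiplicativeLattice.one_eq_top (L := L) ▸ top_ne_bot
  obtain ⟨⟨N, hN⟩, hc⟩ := hf
  suffices ∀ n, ∃ x : L, x ≠ ⊥ ∧ ∀ m : MaxSpace L, multiplicity m.1 x = min (f m) n by
    obtain ⟨x, hx0, hx⟩ := this N
    exact ⟨x, hx0, fun m => by rw [hx, min_eq_left (hN m)]⟩
  intro n
  induction n with
  | zero =>
    exact ⟨1, h10, fun m => by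
      rw [multiplicity_eq_zero hL m.2 (hne m.2) h10 (isPrimeElement_of_isCoatom m.2).not_one_le]
      simp⟩
  | succ n ih =>
    obtain ⟨x, hx0, hx⟩ := ih
    obtain ⟨r, hr0, hr, hV⟩ := exists_V_eq hL h0 (hc (n + 1) (by omega))
    refine ⟨x * r, fun h => (hL.isLatticeDomain _ _ h).elim hx0 hr0, fun m => ?_⟩
    have e : r ≤ m.1 ↔ n + 1 ≤ f m := Set.ext_iff.1 hV m
    rw [multiplicity_mul hL m.2 (hne m.2) hx0 hr0, hx]
    by_cases h : r ≤ m.1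
    · rw [hr.multiplicity_eq_one hL m.2 (hne m.2) hr0 h]
      have := e.1 h
      omega
    · rw [multiplicity_eq_zero hL m.2 (hne m.2) hr0 h]
      have := mt e.2 h
      omega

end Multiplicity

/-! ### Comparing two lattices. -/

section Comparison

variable {L L' : Type*} [CommMonoid L] [CompleteLattice L] [IsMultiplicativeLattice L]
  [CommMonoid L'] [CompleteLattice L'] [IsMultiplicativeLattice L']

/-- Two lattice domains whose nonzero elements are represented, order-reversingly and
multiplicatively, by the same `ℕ`-valued functions are isomorphic. -/
theorem nonempty_orderMonoidIso_of_valuations {X : Type*} (hd : IsLatticeDomain L)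
    (hd' : IsLatticeDomain L') (v : L → X → ℕ) (w : L' → X → ℕ)
    (hv : ∀ x y, x ≠ ⊥ → y ≠ ⊥ → (x ≤ y ↔ v y ≤ v x))
    (hw : ∀ x y, x ≠ ⊥ → y ≠ ⊥ → (x ≤ y ↔ w y ≤ w x))
    (hvm : ∀ x y, x ≠ ⊥ → y ≠ ⊥ → v (x * y) = v x + v y)
    (hwm : ∀ x y, x ≠ ⊥ → y ≠ ⊥ → w (x * y) = w x + w y)
    (hvw : ∀ x, x ≠ ⊥ → ∃ y, y ≠ ⊥ ∧ w y = v x) (hwv : ∀ y, y ≠ ⊥ → ∃ x, x ≠ ⊥ ∧ v x = w y) :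
    Nonempty (L ≃*o L') := by
  classical
  -- `⊥` is matched separately, since the functions represent only nonzero elements.
  have hφ : ∀ x, ∃ y, (x = ⊥ ↔ y = ⊥) ∧ (x ≠ ⊥ → w y = v x) := fun x => by
    by_cases hx : x = ⊥
    · exact ⟨⊥, by simp [hx]⟩
    · obtain ⟨y, hy, h⟩ := hvw x hx
      exact ⟨y, by simp [hx, hy], fun _ => h⟩
  choose φ hφ0 hφ using hφ
  have hle : ∀ x y, φ x ≤ φ y ↔ x ≤ y := by
    intro x y
    by_cases hx : x = ⊥
    · rw [(hφ0 x).1 hx, hx]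
      simp
    by_cases hy : y = ⊥
    · rw [(hφ0 y).1 hy, hy, le_bot_iff, le_bot_iff, hφ0 x]
    · rw [hv x y hx hy, hw _ _ (mt (hφ0 x).2 hx) (mt (hφ0 y).2 hy), hφ x hx, hφ y hy]
  have hinj : Function.Injective φ := fun x y h =>
    le_antisymm ((hle x y).1 h.le) ((hle y x).1 h.ge)
  have hsurj : Function.Surjective φ := fun y => by
    by_cases hy : y = ⊥
    · exact ⟨⊥, by rw [hy]; exact (hφ0 ⊥).1 rfl⟩
    · obtain ⟨x, hx, h⟩ := hwv y hy
      have hx' := mt (hφ0 x).2 hx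
      have he : w (φ x) = w y := (hφ x hx).trans h
      exact ⟨x, le_antisymm ((hw _ _ hx' hy).2 he.ge) ((hw _ _ hy hx').2 he.le)⟩
  have hmul : ∀ x y, φ (x * y) = φ x * φ y := by
    intro x y
    by_cases hx : x = ⊥
    · rw [hx, bot_mul', (hφ0 ⊥).1 rfl, bot_mul']
    by_cases hy : y = ⊥
    · rw [hy, mul_bot', (hφ0 ⊥).1 rfl, mul_bot']
    have hxy : x * y ≠ ⊥ := fun h => (hd _ _ h).elim hx hy
    have h1 := mt (hφ0 _).2 hxy
    have hx' := mt (hφ0 x).2 hx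
    have hy' := mt (hφ0 y).2 hy
    have h2 : φ x * φ y ≠ ⊥ := fun h => (hd' _ _ h).elim hx' hy'
    have he : w (φ (x * y)) = w (φ x * φ y) := by
      rw [hφ _ hxy, hvm x y hx hy, hwm _ _ hx' hy', hφ x hx, hφ y hy]
    exact le_antisymm ((hw _ _ h1 h2).2 he.ge) ((hw _ _ h2 h1).2 he.le)
  exact ⟨{ toEquiv := Equiv.ofBijective φ ⟨hinj, hsurj⟩
           map_mul' := hmul
           map_le_map_iff' := hle _ _ }⟩

theorem IsMultiplicityFunction.comp_homeomorph {X Y : Type*} [TopologicalSpace X]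
    [TopologicalSpace Y] {f : Y → ℕ} (hf : IsMultiplicityFunction f) (h : X ≃ₜ Y) :
    IsMultiplicityFunction (f ∘ h) := by
  obtain ⟨⟨N, hN⟩, hc⟩ := hf
  exact ⟨⟨N, fun m => hN (h m)⟩, fun n hn => h.isCompact_preimage.2 (hc n hn)⟩

theorem eq_one_of_isCoatom_bot (h : IsCoatom (⊥ : L)) {x : L} (hx : x ≠ ⊥) : x = 1 :=
  (h.2 x (bot_lt_iff_ne_bot.2 hx)).trans IsMultiplicativeLattice.one_eq_top.symm

theorem nontrivial_of_nonempty_maxSpace (m : MaxSpace L) : Nontrivial L := ⟨m.1, ⊤, m.2.1⟩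

theorem nonempty_orderMonoidIso_of_homeomorph
    (hL : IsPrincipallyGeneratedRadicalFactorialCLatticeDomain L)
    (hL' : IsPrincipallyGeneratedRadicalFactorialCLatticeDomain L')
    (h₀ : IsCoatom (⊥ : L) ↔ IsCoatom (⊥ : L')) (h : MaxSpace L ≃ₜ MaxSpace L') :
    Nonempty (L ≃*o L') := by
  by_cases hc : IsCoatom (⊥ : L)
  · have hc' := h₀.1 hc
    have h1 : (1 : L) ≠ ⊥ := fun h => hc.1 (h ▸ IsMultiplicativeLattice.one_eq_top)
    have h1' : (1 : L') ≠ ⊥ := fun h => hc'.1 (h ▸ IsMultiplicativeLattice.one_eq_top)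
    -- Here `1` is the only nonzero element of each lattice, so constant functions suffice.
    refine nonempty_orderMonoidIso_of_valuations (X := Unit) hL.isLatticeDomain
      hL'.isLatticeDomain (fun _ _ => 0) (fun _ _ => 0) ?_ ?_ (fun _ _ _ _ => rfl)
      (fun _ _ _ _ => rfl) (fun _ _ => ⟨1, h1', rfl⟩) (fun _ _ => ⟨1, h1, rfl⟩)
    · intro x y hx hy
      simp [eq_one_of_isCoatom_bot hc hx, eq_one_of_isCoatom_bot hc hy]
    · intro x y hx hy
      simp [eq_one_of_isCoatom_bot hc' hx, eq_one_of_isCoatom_bot hc' hy]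
  have hc' : ¬ IsCoatom (⊥ : L') := fun h => hc (h₀.2 h)
  rcases isEmpty_or_nonempty (MaxSpace L) with hE | ⟨⟨m⟩⟩
  · have hE' : IsEmpty (MaxSpace L') := h.symm.toEquiv.isEmpty
    have h1 : ∀ x : L, x = ⊥ := eq_bot_of_isEmpty_maxSpace hL
    have h1' : ∀ x : L', x = ⊥ := eq_bot_of_isEmpty_maxSpace hL'
    exact nonempty_orderMonoidIso_of_valuations (X := Unit) hL.isLatticeDomain
      hL'.isLatticeDomain (fun _ _ => 0) (fun _ _ => 0) (fun x _ hx => absurd (h1 x) hx)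
      (fun x _ hx => absurd (h1' x) hx) (fun _ _ _ _ => rfl) (fun _ _ _ _ => rfl)
      (fun x hx => absurd (h1 x) hx) (fun x hx => absurd (h1' x) hx)
  have := nontrivial_of_nonempty_maxSpace m
  have := nontrivial_of_nonempty_maxSpace (h m)
  have hne : ∀ {m : L}, IsCoatom m → m ≠ ⊥ := fun hm h => hc (h ▸ hm)
  have hne' : ∀ {m : L'}, IsCoatom m → m ≠ ⊥ := fun hm h => hc' (h ▸ hm)
  refine nonempty_orderMonoidIso_of_valuations hL.isLatticeDomain
    hL'.isLatticeDomain (fun x (m : MaxSpace L) => multiplicity m.1 x)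
    (fun y (m : MaxSpace L) => multiplicity (h m).1 y)
    (fun x y hx hy => le_iff_multiplicity_le hL hc hx hy)
    (fun x y hx hy => (le_iff_multiplicity_le hL' hc' hx hy).trans
      h.surjective.forall)
    (fun x y hx hy => funext fun m => multiplicity_mul hL m.2 (hne m.2) hx hy)
    (fun x y hx hy => funext fun m => multiplicity_mul hL' (h m).2 (hne' (h m).2) hx hy)
    (fun x hx => ?_) (fun y hy => ?_)
  · obtain ⟨y, hy, hxy⟩ := ((isMultiplicityFunction_multiplicity hL hc hx).comp_homeomorph
      h.symm).exists_multiplicity_eq hL' hc'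
    exact ⟨y, hy, funext fun m => by simp [hxy]⟩
  · obtain ⟨x, hx, hxy⟩ := ((isMultiplicityFunction_multiplicity hL' hc' hy).comp_homeomorph
      h).exists_multiplicity_eq hL hc
    exact ⟨x, hx, funext fun m => by simp [hxy]⟩

theorem isCompactElement_orderIso {α β : Type*} [CompleteLattice α] [CompleteLattice β]
    (e : α ≃o β) {x : α} (hx : IsCompactElement x) : IsCompactElement (e x) := by
  intro S u hne hdir hu hle
  have hdir' : DirectedOn (· ≤ ·) (e.symm '' S) := by
    rintro _ ⟨a, ha, rfl⟩ _ ⟨b, hb, rfl⟩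
    obtain ⟨c, hc, hac, hbc⟩ := hdir a ha b hb
    exact ⟨_, ⟨c, hc, rfl⟩, e.symm.monotone hac, e.symm.monotone hbc⟩
  obtain ⟨_, ⟨s, hs, rfl⟩, hy⟩ := hx (e.symm '' S) (e.symm u) (hne.image _) hdir'
    (e.symm.isLUB_image'.2 hu) (e.le_symm_apply.2 hle)
  exact ⟨s, hs, e.le_symm_apply.1 hy⟩

/-- The map between spaces of maximal elements induced by an order isomorphism. -/
def maxSpaceMap {α β : Type*} [CompleteLattice α] [CompleteLattice β] (e : α ≃o β)
    (m : MaxSpace α) : MaxSpace β :=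
  ⟨e m.1, (e.isCoatom_iff m.1).2 m.2⟩

theorem continuous_maxSpaceMap {α β : Type*} [CompleteLattice α] [CompleteLattice β]
    (e : α ≃o β) : Continuous (maxSpaceMap e) := by
  refine continuous_generateFrom_iff.2 ?_
  rintro _ ⟨y, hy, rfl⟩
  have h : maxSpaceMap e ⁻¹' V y = V (e.symm y) := by
    ext m
    exact e.symm_apply_le.symm
  rw [h]
  exact isOpen_V (isCompactElement_orderIso e.symm hy)

/-- An order isomorphism induces a homeomorphism between the spaces of maximal elements. -/
def maxSpaceHomeomorph {α β : Type*} [CompleteLattice α] [CompleteLattice β]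
    (e : α ≃o β) : MaxSpace α ≃ₜ MaxSpace β where
  toFun := maxSpaceMap e
  invFun := maxSpaceMap e.symm
  left_inv m := Subtype.ext (e.symm_apply_apply m.1)
  right_inv m := Subtype.ext (e.apply_symm_apply m.1)
  continuous_toFun := continuous_maxSpaceMap e
  continuous_invFun := continuous_maxSpaceMap e.symm

end Comparison

end MultiplicativeLattice

open MultiplicativeLattice in
/-- Isomorphisms of multiplicative lattices are the multiplicative order isomorphisms `L ≃*o L'`.
The hypothesis `h₀` says that `0` is a maximal element in both lattices or in neither, that is,
that both or neither of them have exactly two elements. -/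
theorem corollary6p6 {L : Type*} {L' : Type*}
    [CommMonoid L] [CompleteLattice L] [IsMultiplicativeLattice L]
    [CommMonoid L'] [CompleteLattice L'] [IsMultiplicativeLattice L']
    (hL : IsPrincipallyGeneratedRadicalFactorialCLatticeDomain L)
    (hL' : IsPrincipallyGeneratedRadicalFactorialCLatticeDomain L')
    (h₀ : IsCoatom (⊥ : L) ↔ IsCoatom (⊥ : L')) :
    Nonempty (L ≃*o L') ↔ Nonempty (MaxSpace L ≃ₜ MaxSpace L') :=
  ⟨fun ⟨e⟩ => ⟨maxSpaceHomeomorph ⟨e.toEquiv, e.map_le_map_iff'⟩⟩,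
    fun ⟨h⟩ => nonempty_orderMonoidIso_of_homeomorph hL hL' h₀ h⟩
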